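/- Let $T,O,n_x,n_u,n_y,n_X,L,L_{\mathcal C}$ be natural numbers. An ego vehicle has a given initial state $x_0\in\mathbb R^{n_x}$, dynamics $x_{t+1}=f_t(x_t,u_t)$ for $t=0,\dots,T-1$ and outputs $y_t=h_t(x_t)\in\mathbb R^{n_y}$ for $t=1,\dots,T$ (for instance with $f_t,h_t$ linear), and its inputs, states and outputs must lie in given sets $\mathcal U,\mathcal X,\mathcal Y$. The predicted states $X_{t,o}\in\mathbb R^{n_X}$ of the other vehicles $o=1,\dots,O$ at times $t=1,\dots,T$ are random with joint law $P$, and $X_o=(X_{1,o},\dots,X_{T,o})$. The obstacle set of a predicted state $x$ is $\mathcal O(x)=\{y\in\mathbb R^{n_y}: A(x)y<b(x)\}$, where $A:\mathbb R^{n_X}\to\mathbb R^{L\times n_y}$ and $b:\mathbb R^{n_X}\to\mathbb R^{L}$ are continuous; assume that almost surely all sets $\mathcal O(X_{t,o})$ are bounded (polytopes). Given an objective $J$ and a risk level $\epsilon$, the chance-constrained motion-planning problem is to minimize $J(u)$ over trajectories $(u,x,y)$ as above such that $$P\big(y_t\notin\mathcal O(X_{t,o})\ \text{for all } t=1,\dots,T,\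 o=1,\dots,O\big)\ge 1-\epsilon .$$ For each $o$ let a fixed measurable clustering function $g_o$ assign to each trajectory $X_o$ a cluster $g_o(X_o)\in\{1,\dots,K_o\}$. Let $\epsilon,\beta\in(0,1)$, and let $\epsilon_o^k,\beta_o^k\in(0,1)$ satisfy $$\sum_{o=1}^O\sum_{k=1}^{K_o}\epsilon_o^k=\epsilon,\qquad \sum_{o=1}^O\sum_{k=1}^{K_o}\beta_o^k=\beta .$$ For each pair $(o,k)$ let $N_o^k$ satisfy, with $n_c=L_{\mathcal C}T$ and $n_b=0$, $$2^{n_b}\sum_{i=0}^{n_c-1}\binom{N_o^k}{i}(\epsilon_o^k)^i(1-\epsilon_o^k)^{N_o^k-i}\le\beta_o^k ,$$ and let $N_o^k$ independent samples of $X_o$ in cluster $k$ be given, that is, independent draws from the conditional law of $X_o$ given $g_o(X_o)=k$ (nothing is assumed on the joint law of samples belonging to different pairs). Fix in advance matrices $\bar A_{t,o}^k\in\mathbb R^{L_{\mathcal C}\times n_y}$. For each pair $(o,k)$ consider the linear program of minimizing $\sum_{t}\sum_j(\bar b_{t,o}^k)_j$ over $\bar b_{t,o}^k\in\mathbb R^{L_{\mathcal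 C}}$, $t=1,\dots,T$, subject to $\bar A_{t,o}^kv\le\bar b_{t,o}^k$ for all $t$ and all vertices $v$ of the obstacle sets at time $t$ of the samples of the pair $(o,k)$ (vertices of the closure of these open sets), and let $\mathcal C_{t,o}^k=\{y:\bar A_{t,o}^ky\le\bar b_{t,o}^k\}$. The mixed-integer planning problem is to minimize $J(u)$ over trajectories $(u,x,y)$ as above with $y_t\notin\mathcal C_{t,o}^k$ for all $t,o,k$. Then, with probability at least $1-\beta$ over the samples, the following holds: for every choice of feasible solutions $\bar b$ of the linear programs, in particular for optimal ones, every feasible solution of the mixed-integer planning problem is a feasible solution of the chance-constrained motion-planning problem with risk level $\epsilon$. -/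

import Mathlib

open MeasureTheory ProbabilityTheory Matrix

/-- Data of the motion planning problem of the ego vehicle over a horizon of `T` steps, among other
vehicles whose predicted states live in `ℝ^nX`; obstacle sets are described by `L` halfspaces.
The index `t : Fin T` of inputs and of the dynamics stands for time `t = 0, …, T-1`; the index
`t : Fin T` of outputs, output maps and obstacles stands for time `t + 1 = 1, …, T`. -/
structure PlanningProblem (T nx nu ny nX L : ℕ) where
  /-- objective function `J` of the input sequence (irrelevant for feasibility) -/
  cost : (Fin T → Fin nu → ℝ) → ℝ
  /-- initial state of the ego vehicle -/
  x₀ : Fin nx → ℝ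
  /-- dynamics `x_{t+1} = f_t (x_t, u_t)` -/
  f : Fin T → (Fin nx → ℝ) → (Fin nu → ℝ) → (Fin nx → ℝ)
  /-- output maps `y_t = h_t (x_t)`, for `t = 1, …, T` -/
  h : Fin T → (Fin nx → ℝ) → (Fin ny → ℝ)
  /-- the set of admissible states -/
  stateSet : Set (Fin nx → ℝ)
  /-- the set of admissible inputs -/
  inputSet : Set (Fin nu → ℝ)
  /-- the set of admissible outputs -/
  outputSet : Set (Fin ny → ℝ)
  /-- normal vectors of the halfspaces of the obstacle set, as a function of the predicted state -/
  A : (Fin nX → ℝ) → Matrix (Fin L) (Fin ny) ℝ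
  /-- offsets of the halfspaces of the obstacle set, as a function of the predicted state -/
  b : (Fin nX → ℝ) → (Fin L → ℝ)

namespace PlanningProblem

variable {T nx nu ny nX L : ℕ} (p : PlanningProblem T nx nu ny nX L)

/-- The (open) polytopic obstacle set `{y | A(x) y < b(x)}` of a predicted state `x`. -/
def obstacle (x : Fin nX → ℝ) : Set (Fin ny → ℝ) :=
  {y | ∀ j, (p.A x *ᵥ y) j < p.b x j}

/-- The vertices of the obstacle set: the extreme points of its closure. -/
def vertices (x : Fin nX → ℝ) : Set (Fin ny → ℝ) :=
  Set.extremePoints ℝ (closure (p.obstacle x))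

/-- `(u, x, y)` satisfies the constraints that both planning problems share: admissible inputs,
states and outputs, the dynamics and the output equation. -/
def IsTrajectory (u : Fin T → Fin nu → ℝ) (x : Fin (T + 1) → Fin nx → ℝ)
    (y : Fin T → Fin ny → ℝ) : Prop :=
  (∀ t, u t ∈ p.inputSet) ∧ (∀ t, x t ∈ p.stateSet) ∧ (∀ t, y t ∈ p.outputSet) ∧
  x 0 = p.x₀ ∧
  (∀ t : Fin T, x t.succ = p.f t (x t.castSucc) (u t)) ∧
  (∀ t : Fin T, y t = p.h t (x t.succ))

/-- Feasibility for the chance-constrained planning problem with risk level `ε`, where `P` is the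
joint law of the predicted trajectories `X o t` of the `O` other vehicles. -/
def ChanceFeasible {O : ℕ} (P : Measure (Fin O → Fin T → Fin nX → ℝ)) (ε : ℝ)
    (u : Fin T → Fin nu → ℝ) (x : Fin (T + 1) → Fin nx → ℝ) (y : Fin T → Fin ny → ℝ) : Prop :=
  p.IsTrajectory u x y ∧ 1 - ε ≤ P.real {X | ∀ t o, y t ∉ p.obstacle (X o t)}

/-- Feasibility for the linear program of one cluster, which minimizes `∑ t, ∑ j, bbar t j` over
`bbar` subject to `Abar t v ≤ bbar t` for all vertices `v` of the obstacle sets, at each time `t`,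
of the `N` sampled trajectories `s i`. An optimal solution is in particular feasible. -/
def LPFeasible {LC N : ℕ} (Abar : Fin T → Matrix (Fin LC) (Fin ny) ℝ)
    (s : Fin N → Fin T → Fin nX → ℝ) (bbar : Fin T → Fin LC → ℝ) : Prop :=
  ∀ t i, ∀ v ∈ p.vertices (s i t), ∀ j, (Abar t *ᵥ v) j ≤ bbar t j

/-- Feasibility for the deterministic (mixed-integer) planning problem: at each time the output
avoids the bounding polytope `{y | Abar y ≤ bbar}` of each cluster of each other vehicle. -/
def PolytopeFeasible {O LC : ℕ} {K : Fin O → ℕ}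
    (Abar : (o : Fin O) → Fin (K o) → Fin T → Matrix (Fin LC) (Fin ny) ℝ)
    (bbar : (o : Fin O) → Fin (K o) → Fin T → Fin LC → ℝ)
    (u : Fin T → Fin nu → ℝ) (x : Fin (T + 1) → Fin nx → ℝ) (y : Fin T → Fin ny → ℝ) : Prop :=
  p.IsTrajectory u x y ∧
    ∀ o k t, y t ∉ {z : Fin ny → ℝ | ∀ j, (Abar o k t *ᵥ z) j ≤ bbar o k t j}

end PlanningProblem

/-- The law of the predicted trajectory of vehicle `o` conditioned on the clustering function `g`
of that vehicle assigning it to cluster `k`. -/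
noncomputable def clusterLaw {O T nX K : ℕ} (P : Measure (Fin O → Fin T → Fin nX → ℝ)) (o : Fin O)
    (g : (Fin T → Fin nX → ℝ) → Fin K) (k : Fin K) : Measure (Fin T → Fin nX → ℝ) :=
  (P.map (fun X => X o))[|g ⁻¹' {k}]

/-- The scenario sample-size condition with `nc` continuous and `nb` binary variables:
`2^nb ∑_{i=0}^{nc-1} (N choose i) ε^i (1-ε)^(N-i) ≤ β`. -/
def SampleSizeCondition (nc nb N : ℕ) (ε β : ℝ) : Prop :=
  2 ^ nb * ∑ i ∈ Finset.range nc, (N.choose i : ℝ) * ε ^ i * (1 - ε) ^ (N - i) ≤ β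

/-! Avoiding all bounding polytopes leaves, for each pair `(o, k)`, only collisions with
trajectories that exceed every sample in one of `LC * T` support values, the suprema of `Abar y`
over the obstacle sets (`collisionSet_subset_exceedSet`; bounds at vertices extend to bounded
obstacle sets by Krein-Milman). This exceedance set depends on the samples alone, not on `bbar` or
the plan. It is therefore enough to bound its mass under each cluster law, which gives the
conclusion for all feasible choices at once; union bounds over pairs and total probability over
clusters then add up the `βc` and the `εc`.

The probabilistic core is a bound for coordinatewise maxima of `N` independent samples of a finite
measure `Q` of mass `q`: the exceedance set has mass more than `v` with probability at most
`binomTail n N q v`. For null level sets (`pi_lt_measure_exceedSet_le_of_noAtoms`) the proof is by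
induction on the number `n` of coordinates. Let `a` be a sample maximal in coordinate 0 and `w` the
mass above it. Either `w > v`, so that all samples lie in a set of mass at most `q - v`, or the
other samples lie in the part of mass `q - w` not above `a`, where the remaining coordinates must
miss more than `v - w`. The induction hypothesis applies to `Q` restricted to this part, which is
why general finite measures occur, and integration over `a` produces the next binomial tail. A small
random perturbation removes the assumption on level sets (`pi_lt_measure_exceedSet_le`). -/

/-! ### Distribution of the upper-tail mass of one real function -/

section Tail

variable {S : Type*} [MeasurableSpace S] (Q : Measure S) (m : S → ℝ)

/-- Mass of the points at which `m` is strictly larger than at `x`. -/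
noncomputable def upperMass (x : S) : ENNReal := Q {s | m x < m s}

variable {m}

lemma upperMass_anti {x y : S} (h : m x ≤ m y) : upperMass Q m y ≤ upperMass Q m x :=
  measure_mono fun _ hs => lt_of_le_of_lt h hs

lemma measurable_upperMass [SFinite Q] (hm : Measurable m) : Measurable (upperMass Q m) := by
  have : MeasurableSet {p : S × S | m p.1 < m p.2} :=
    measurableSet_lt (hm.comp measurable_fst) (hm.comp measurable_snd)
  exact measurable_measure_prodMk_left this

/-- The mass of a set defined by a condition on `m` is at most `r` if this holds for the preimages
of compact sets. -/
lemma measure_preimage_le_of_isCompact [IsFiniteMeasure Q] (hm : Measurable m) {U : Set ℝ}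
    (hU : MeasurableSet U) {r : ENNReal}
    (h : ∀ C ⊆ U, IsCompact C → C.Nonempty → Q (m ⁻¹' C) ≤ r) : Q (m ⁻¹' U) ≤ r := by
  rw [← Measure.map_apply hm hU, hU.measure_eq_iSup_isCompact]
  refine iSup_le fun C => iSup_le fun hC => iSup_le fun hc => ?_
  rcases C.eq_empty_or_nonempty with rfl | hne
  · simp
  · rw [Measure.map_apply hm hc.measurableSet]
    exact h C hC hc hne

/-- On a compact set of admissible levels with least element `c`, all values are `c` or lie above
`c`; the level set is null and the tail above `c` has mass at most `r`. Together with the next bound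
this replaces the uniform distribution of `upperMass` on `[0, q]`. -/
lemma measure_upperMass_le [IsFiniteMeasure Q] (hm : Measurable m)
    (h0 : ∀ c, Q {x | m x = c} = 0) (r : ENNReal) : Q {x | upperMass Q m x ≤ r} ≤ r := by
  let U : Set ℝ := {c | Q {s | c < m s} ≤ r}
  have hU : IsUpperSet U := fun a b hab ha =>
    (measure_mono fun s (hs : b < m s) => lt_of_le_of_lt hab hs).trans ha
  refine measure_preimage_le_of_isCompact Q hm hU.ordConnected.measurableSet fun C hCU hC hne => ?_
  obtain ⟨c, hc, hmin⟩ := hC.exists_isLeast hne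
  calc Q (m ⁻¹' C) ≤ Q ({s | m s = c} ∪ {s | c < m s}) :=
        measure_mono fun s hs => (hmin hs).eq_or_lt.imp Eq.symm id
    _ ≤ Q {s | m s = c} + Q {s | c < m s} := measure_union_le _ _
    _ ≤ r := by rw [h0, zero_add]; exact hCU hc

/-- Dually, values in a compact set with greatest element `c` miss the tail above `c`, whose mass
exceeds `r`. Atoms do no harm here. -/
lemma measure_lt_upperMass_le [IsFiniteMeasure Q] (hm : Measurable m) (r : ENNReal) :
    Q {x | r < upperMass Q m x} ≤ Q Set.univ - r := by
  let U : Set ℝ := {c | r < Q {s | c < m s}}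
  have hU : IsLowerSet U := fun a b hab ha =>
    lt_of_lt_of_le ha (measure_mono fun s (hs : a < m s) => lt_of_le_of_lt hab hs)
  refine measure_preimage_le_of_isCompact Q hm hU.ordConnected.measurableSet fun C hCU hC hne => ?_
  obtain ⟨c, hc, hmax⟩ := hC.exists_isGreatest hne
  have hmeas : MeasurableSet {s | c < m s} := measurableSet_lt measurable_const hm
  calc Q (m ⁻¹' C) ≤ Q {s | c < m s}ᶜ := measure_mono fun s hs => not_lt.2 (hmax hs)
    _ = Q Set.univ - Q {s | c < m s} := measure_compl hmeas (measure_ne_top _ _)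
    _ ≤ Q Set.univ - r := tsub_le_tsub_left (le_of_lt (hCU hc)) _

/-- For a uniform variable `w` this is the integral of `(v - w) ^ i` over `[0, v]`. In general the
layer-cake formula reduces it to the distribution bound `measure_upperMass_le`. -/
lemma lintegral_upperMass_pow_le [IsFiniteMeasure Q] (hm : Measurable m)
    (h0 : ∀ c, Q {x | m x = c} = 0) {v : ENNReal} (hv : v ≠ ⊤) (i : ℕ) :
    (i + 1) * ∫⁻ x in {x | upperMass Q m x ≤ v}, (v - upperMass Q m x) ^ i ∂Q ≤ v ^ (i + 1) := by
  -- The layer-cake formula needs a positive exponent, so exponent 0 is separate.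
  rcases i with _ | i
  · simpa using measure_upperMass_le Q hm h0 v
  lift v to NNReal using hv
  have hwm := measurable_upperMass Q hm
  set f : S → ℝ := fun x => ((v : ENNReal) - upperMass Q m x).toReal
  have hfm : Measurable f := (measurable_const.sub hwm).ennreal_toReal
  have htop : ∀ x, (v : ENNReal) - upperMass Q m x ≠ ⊤ := fun x =>
    ne_top_of_le_ne_top ENNReal.coe_ne_top tsub_le_self
  -- Where `f ≥ t > 0`, the upper mass is at most `v - t`; this set has mass at most `v - t`, and is
  -- null for `t > v`.
  have hlev : ∀ t ∈ Set.Ioi (0 : ℝ), Q {x | t ≤ f x} * ENNReal.ofReal (t ^ ((i + 1 : ℝ) - 1)) ≤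
      (Set.Ioc 0 (v : ℝ)).indicator (fun t => ENNReal.ofReal ((v - t) * t ^ i)) t := by
    intro t ht
    have ht0 : 0 < t := ht
    have key : Q {x | t ≤ f x} ≤ ENNReal.ofReal (v - t) := by
      refine (measure_mono fun x (hx : t ≤ f x) => ?_).trans
        (measure_upperMass_le Q hm h0 (ENNReal.ofReal (v - t)))
      have h1 : ENNReal.ofReal t ≤ v - upperMass Q m x :=
        (ENNReal.ofReal_le_iff_le_toReal (htop x)).2 hx
      have hle : upperMass Q m x ≤ v := by
        by_contra h
        rw [tsub_eq_zero_of_le (not_le.1 h).le] at h1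
        exact absurd ht0 (not_lt.2 (ENNReal.ofReal_eq_zero.1 (le_zero_iff.1 h1)))
      show upperMass Q m x ≤ ENNReal.ofReal (v - t)
      rw [ENNReal.ofReal_sub _ ht0.le, ENNReal.ofReal_coe_nnreal]
      refine ENNReal.le_sub_of_add_le_left ENNReal.ofReal_ne_top ?_
      calc ENNReal.ofReal t + upperMass Q m x ≤ v - upperMass Q m x + upperMass Q m x := by gcongr
        _ = v := tsub_add_cancel_of_le hle
    have hpow : t ^ ((i + 1 : ℝ) - 1) = t ^ i := by
      rw [add_sub_cancel_right, Real.rpow_natCast]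
    rw [hpow]
    by_cases htv : t ≤ v
    · rw [Set.indicator_of_mem (show t ∈ Set.Ioc 0 (v : ℝ) from ⟨ht0, htv⟩),
        ENNReal.ofReal_mul (sub_nonneg.2 htv)]
      gcongr
    · have : Q {x | t ≤ f x} = 0 := by
        rw [ENNReal.ofReal_of_nonpos (by linarith)] at key
        exact le_zero_iff.1 key
      simp [this]
  have hint : ∫ t in (0 : ℝ)..v, (v - t) * t ^ i = v ^ (i + 2) * (1 / (i + 1) - 1 / (i + 2)) := by
    have : ∀ t : ℝ, (v - t) * t ^ i = v * t ^ i - t ^ (i + 1) := fun t => by ring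
    simp_rw [this]
    rw [intervalIntegral.integral_sub, intervalIntegral.integral_const_mul, integral_pow,
      integral_pow]
    · push_cast
      field_simp
      ring
    · exact (by fun_prop : Continuous fun t : ℝ => (v : ℝ) * t ^ i).intervalIntegrable _ _
    · exact (by fun_prop : Continuous fun t : ℝ => t ^ (i + 1)).intervalIntegrable _ _
  have hlint : ∫⁻ t in Set.Ioc 0 (v : ℝ), ENNReal.ofReal ((v - t) * t ^ i) =
      ENNReal.ofReal (v ^ (i + 2) * (1 / (i + 1) - 1 / (i + 2))) := by
    rw [← hint, intervalIntegral.integral_of_le v.coe_nonneg, ofReal_integral_eq_lintegral_ofReal]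
    · exact ((by fun_prop : Continuous fun t : ℝ => (v - t) * t ^ i).integrableOn_Icc).mono_set
        Set.Ioc_subset_Icc_self
    · refine (ae_restrict_iff' measurableSet_Ioc).2 (ae_of_all _ fun t ht => ?_)
      exact mul_nonneg (sub_nonneg.2 ht.2) (pow_nonneg ht.1.le _)
  have hlc := lintegral_rpow_eq_lintegral_meas_le_mul Q (f := f) (p := (i + 1 : ℝ))
    (ae_of_all _ fun _ => ENNReal.toReal_nonneg) hfm.aemeasurable (by positivity)
  have hrw : ∀ x, ((v : ENNReal) - upperMass Q m x) ^ (i + 1) =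
      ENNReal.ofReal (f x ^ (i + 1 : ℝ)) := fun x => by
    rw [← Nat.cast_add_one, Real.rpow_natCast, ENNReal.ofReal_pow ENNReal.toReal_nonneg,
      ENNReal.ofReal_toReal (htop x)]
  calc ((i + 1 : ℕ) + 1 : ENNReal) *
        ∫⁻ x in {x | upperMass Q m x ≤ v}, (v - upperMass Q m x) ^ (i + 1) ∂Q
      ≤ ((i + 1 : ℕ) + 1 : ENNReal) * ∫⁻ x, ENNReal.ofReal (f x ^ (i + 1 : ℝ)) ∂Q := by
        rw [← funext hrw]
        exact mul_le_mul_right (setLIntegral_le_lintegral _ _) _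
    _ ≤ ((i + 1 : ℕ) + 1 : ENNReal) * (ENNReal.ofReal (i + 1) *
          ENNReal.ofReal (v ^ (i + 2) * (1 / (i + 1) - 1 / (i + 2)))) := by
        rw [hlc, ← hlint]
        exact mul_le_mul_right (mul_le_mul_right
          ((setLIntegral_mono' measurableSet_Ioi hlev).trans ((setLIntegral_le_lintegral _ _).trans_eq
            (lintegral_indicator measurableSet_Ioc _))) _) _
    _ = (v : ENNReal) ^ (i + 1 + 1) := by
        rw [← Nat.cast_add_one, ← ENNReal.ofReal_natCast, ← ENNReal.ofReal_mul (by positivity),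
          ← ENNReal.ofReal_mul (by positivity), ← ENNReal.ofReal_coe_nnreal,
          ← ENNReal.ofReal_pow v.coe_nonneg]
        congr 1
        push_cast
        field_simp
        ring

end Tail

/-! ### Binomial tail bound for coordinatewise maxima without atoms -/

section Core

variable {S : Type*}

/-- The points that exceed, in some coordinate `d`, the values of `m d` at all points `x i`. -/
def exceedSet {ι κ : Type*} (m : ι → S → ℝ) (x : κ → S) : Set S :=
  {s | ∃ d, ∀ i, m d (x i) < m d s}

/-- Removing the upper tail of the first coordinate beyond the sample `a` leaves, for the
remaining samples, the violation problem of the other coordinates. -/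
lemma exceedSet_insertNth_subset {n N : ℕ} (m : Fin (n + 1) → S → ℝ) (i : Fin (N + 1)) (a : S)
    (y : Fin N → S) :
    exceedSet m (i.insertNth a y : Fin (N + 1) → S) ⊆
      {s | m 0 a < m 0 s} ∪ (exceedSet (fun d : Fin n => m d.succ) y ∩ {s | m 0 s ≤ m 0 a}) := by
  rintro s ⟨d, hd⟩
  by_cases h : m 0 a < m 0 s
  · exact Or.inl h
  refine Or.inr ⟨?_, not_lt.1 h⟩
  induction d using Fin.cases with
  | zero => exact absurd (by simpa using hd i) h
  | succ d => exact ⟨d, fun j => by simpa using hd (i.succAbove j)⟩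

variable [MeasurableSpace S]

lemma measurableSet_exceedSet_prod {ι κ : Type*} [Countable ι] [Countable κ] {m : ι → S → ℝ}
    (hm : ∀ d, Measurable (m d)) :
    MeasurableSet {p : (κ → S) × S | p.2 ∈ exceedSet m p.1} := by
  have : {p : (κ → S) × S | p.2 ∈ exceedSet m p.1} =
      ⋃ d, ⋂ i, {p : (κ → S) × S | m d (p.1 i) < m d p.2} := by
    ext p
    simp [exceedSet]
  rw [this]
  exact .iUnion fun d => .iInter fun i => measurableSet_lt
    ((hm d).comp ((measurable_pi_apply i).comp measurable_fst)) ((hm d).comp measurable_snd)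

lemma measurable_measure_exceedSet {ι κ : Type*} [Countable ι] [Countable κ] (Q : Measure S)
    [SFinite Q] {m : ι → S → ℝ} (hm : ∀ d, Measurable (m d)) :
    Measurable fun x : κ → S => Q (exceedSet m x) :=
  measurable_measure_prodMk_left (measurableSet_exceedSet_prod hm)

lemma measurableSet_exceedSet {ι κ : Type*} [Countable ι] [Countable κ] {m : ι → S → ℝ}
    (hm : ∀ d, Measurable (m d)) (x : κ → S) : MeasurableSet (exceedSet m x) :=
  measurable_prodMk_left (measurableSet_exceedSet_prod hm)

/-- Binomial tail of the scenario approach, for a measure of total mass `q`. -/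
noncomputable def binomTail (n N : ℕ) (q v : ENNReal) : ENNReal :=
  ∑ i ∈ Finset.range n, (N.choose i : ENNReal) * v ^ i * (q - v) ^ (N - i)

/-- This is the induction step conditioned on the sample `a` at position `i` being maximal in
coordinate 0. The hypothesis `ih` is restricted to measures below `Q` because these inherit null
level sets. -/
lemma pi_section_le {n N : ℕ} (Q : Measure S) [IsFiniteMeasure Q] {m : Fin (n + 1) → S → ℝ}
    (hm : ∀ d, Measurable (m d)) {v : ENNReal} (hv : v ≠ ⊤) (i : Fin (N + 1))
    (ih : ∀ (R : Measure S) [IsFiniteMeasure R], R ≤ Q → ∀ r : ENNReal, r ≠ ⊤ →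
      (Measure.pi fun _ : Fin N => R) {y | r < R (exceedSet (fun d : Fin n => m d.succ) y)} ≤
        binomTail n N (R Set.univ) r)
    {a : S} (ha : upperMass Q (m 0) a ≤ v) :
    (Measure.pi fun _ : Fin N => Q)
      {y | (∀ j, m 0 (y j) ≤ m 0 a) ∧ v < Q (exceedSet m (i.insertNth a y : Fin (N + 1) → S))} ≤
      ∑ k ∈ Finset.range n, (N.choose k : ENNReal) * (v - upperMass Q (m 0) a) ^ k *
        (Q Set.univ - v) ^ (N - k) := by
  set w := upperMass Q (m 0) a with hw
  let H : Set S := {s | m 0 s ≤ m 0 a}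
  have hH : MeasurableSet H := measurableSet_le (hm 0) measurable_const
  have hm' : ∀ d : Fin n, Measurable (m d.succ) := fun d => hm _
  have hHc : Q H = Q Set.univ - w := by
    have h1 : MeasurableSet {s | m 0 a < m 0 s} := measurableSet_lt measurable_const (hm 0)
    rw [hw, upperMass, ← measure_compl h1 (measure_ne_top _ _)]
    congr 1
    ext s
    simp [H]
  -- Mass and threshold both drop by `w`, so their difference stays `q - v` and its powers do not
  -- depend on `a`.
  have hsub : Q H - (v - w) = Q Set.univ - v := by
    rw [hHc, tsub_tsub, add_tsub_cancel_of_le ha]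
  calc _ ≤ (Measure.pi fun _ : Fin N => Q)
        ({y | v - w < (Q.restrict H) (exceedSet (fun d : Fin n => m d.succ) y)} ∩
          Set.univ.pi fun _ => H) := by
        refine measure_mono ?_
        rintro y ⟨hy, hvy⟩
        refine ⟨?_, fun j _ => hy j⟩
        show v - w < (Q.restrict H) (exceedSet (fun d : Fin n => m d.succ) y)
        rw [Measure.restrict_apply (measurableSet_exceedSet hm' y)]
        have h2 : v < w + Q (exceedSet (fun d : Fin n => m d.succ) y ∩ H) :=
          hvy.trans_le ((measure_mono (exceedSet_insertNth_subset m i a y)).trans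
            (measure_union_le _ _))
        exact ENNReal.sub_lt_of_lt_add ha (by rwa [add_comm])
    _ = (Measure.pi fun _ : Fin N => Q.restrict H)
          {y | v - w < (Q.restrict H) (exceedSet (fun d : Fin n => m d.succ) y)} := by
        rw [← Measure.restrict_pi_pi, Measure.restrict_apply]
        exact measurableSet_lt measurable_const (measurable_measure_exceedSet _ hm')
    _ ≤ binomTail n N ((Q.restrict H) Set.univ) (v - w) :=
        ih _ Measure.restrict_le_self _ (ENNReal.sub_ne_top hv)
    _ = _ := by
        rw [binomTail, Measure.restrict_apply_univ, hsub]

/-- The induction removes one coordinate and one sample at a time: the case where all samples have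
upper mass above `v` gives the term `i = 0` of the tail, and the term `k` of the smaller tail gives
the term `k + 1`. -/
theorem pi_lt_measure_exceedSet_le_of_noAtoms {n N : ℕ} (Q : Measure S) [IsFiniteMeasure Q]
    {m : Fin n → S → ℝ} (hm : ∀ d, Measurable (m d)) (h0 : ∀ d c, Q {x | m d x = c} = 0)
    {v : ENNReal} (hv : v ≠ ⊤) :
    (Measure.pi fun _ : Fin N => Q) {x | v < Q (exceedSet m x)} ≤
      binomTail n N (Q Set.univ) v := by
  induction n generalizing N Q v with
  | zero => simp [exceedSet, binomTail]
  | succ n ih =>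
    -- Without samples there is no maximal one, but the term `i = 0` of the tail is already 1.
    rcases N with _ | N
    · rw [binomTail, Finset.sum_range_succ']
      refine (measure_mono (Set.subset_univ _)).trans ?_
      simp
    set w := upperMass Q (m 0)
    have hwm : Measurable w := measurable_upperMass Q (hm 0)
    -- The maximal sample is at position `i`. Ties make these events overlap, which is harmless for
    -- a union bound.
    let B : Fin (N + 1) → Set (Fin (N + 1) → S) := fun i =>
      {x | w (x i) ≤ v ∧ (∀ j, m 0 (x (i.succAbove j)) ≤ m 0 (x i)) ∧ v < Q (exceedSet m x)}
    have hcover : {x : Fin (N + 1) → S | v < Q (exceedSet m x)} ⊆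
        (Set.univ.pi fun _ => {s | v < w s}) ∪ ⋃ i, B i := by
      intro x hx
      obtain ⟨i, hi⟩ := Finite.exists_max fun i => m 0 (x i)
      by_cases hvi : v < w (x i)
      · exact Or.inl fun j _ => hvi.trans_le (upperMass_anti Q (hi j))
      · exact Or.inr (Set.mem_iUnion.2 ⟨i, not_lt.1 hvi, fun j => hi _, hx⟩)
    have hBm : ∀ i, MeasurableSet (B i) := fun i => by
      refine (measurableSet_le (hwm.comp (measurable_pi_apply i)) measurable_const).inter
        (MeasurableSet.inter ?_ (measurableSet_lt measurable_const
          (measurable_measure_exceedSet Q hm)))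
      have : {x : Fin (N + 1) → S | ∀ j, m 0 (x (i.succAbove j)) ≤ m 0 (x i)} =
          ⋂ j, {x | m 0 (x (i.succAbove j)) ≤ m 0 (x i)} := by ext; simp
      exact (congrArg MeasurableSet this).mpr (MeasurableSet.iInter fun j => measurableSet_le
        ((hm 0).comp (measurable_pi_apply _)) ((hm 0).comp (measurable_pi_apply _)))
    have hB : ∀ i, (Measure.pi fun _ : Fin (N + 1) => Q) (B i) ≤
        ∑ k ∈ Finset.range n, (N.choose k : ENNReal) * (Q Set.univ - v) ^ (N - k) *
          ∫⁻ a in {a | w a ≤ v}, (v - w a) ^ k ∂Q := by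
      intro i
      have hmp := measurePreserving_piFinSuccAbove (fun _ : Fin (N + 1) => Q) i
      rw [← hmp.symm.measure_preimage_equiv (B i),
        Measure.prod_apply ((MeasurableEquiv.measurable _) (hBm i))]
      have hms : MeasurableSet {a | w a ≤ v} := measurableSet_le hwm measurable_const
      calc _ ≤ ∫⁻ a, {a | w a ≤ v}.indicator (fun a => ∑ k ∈ Finset.range n,
              (N.choose k : ENNReal) * (v - w a) ^ k * (Q Set.univ - v) ^ (N - k)) a ∂Q := by
            refine lintegral_mono fun a => ?_
            by_cases ha : w a ≤ v
            · rw [Set.indicator_of_mem (show a ∈ {a | w a ≤ v} from ha)]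
              refine (measure_mono ?_).trans (pi_section_le Q hm hv i ?_ ha)
              · rintro y ⟨-, hy2, hy3⟩
                refine ⟨fun j => ?_, hy3⟩
                have h : m 0 ((i.insertNth a y : Fin (N + 1) → S) (i.succAbove j)) ≤
                  m 0 ((i.insertNth a y : Fin (N + 1) → S) i) := hy2 j
                simpa using h
              · intro R _ hR r hr
                exact ih R (fun d => hm _)
                  (fun d c => le_zero_iff.1 ((hR _).trans_eq (h0 _ c))) hr
            · refine (measure_mono_null ?_ measure_empty).le.trans zero_le
              rintro y ⟨hy1, -⟩
              have h : w ((i.insertNth a y : Fin (N + 1) → S) i) ≤ v := hy1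
              exact absurd (by simpa using h) ha
        _ = _ := by
            rw [lintegral_indicator hms, lintegral_finsetSum]
            · refine Finset.sum_congr rfl fun k _ => ?_
              rw [← lintegral_const_mul]
              · exact lintegral_congr fun a => by ring
              · exact (measurable_const.sub hwm).pow_const k
            · exact fun k _ => (((measurable_const.sub hwm).pow_const k).const_mul _).mul_const _
    calc _ ≤ (Measure.pi fun _ : Fin (N + 1) => Q) (Set.univ.pi fun _ => {s | v < w s}) +
          ∑ i, (Measure.pi fun _ : Fin (N + 1) => Q) (B i) :=
          (measure_mono hcover).trans ((measure_union_le _ _).trans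
            (add_le_add_right (measure_iUnion_fintype_le _ _) _))
      _ ≤ (Q Set.univ - v) ^ (N + 1) +
          (N + 1) * ∑ k ∈ Finset.range n, (N.choose k : ENNReal) * (Q Set.univ - v) ^ (N - k) *
            ∫⁻ a in {a | w a ≤ v}, (v - w a) ^ k ∂Q := by
          refine add_le_add ?_ ((Finset.sum_le_sum fun i _ => hB i).trans_eq (by simp))
          rw [Measure.pi_pi, Finset.prod_const, Finset.card_univ, Fintype.card_fin]
          exact pow_le_pow_left' (measure_lt_upperMass_le Q (hm 0) v) _
      _ ≤ binomTail (n + 1) (N + 1) (Q Set.univ) v := by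
          rw [binomTail, Finset.sum_range_succ', add_comm]
          refine add_le_add ?_ (by simp)
          rw [Finset.mul_sum]
          refine Finset.sum_le_sum fun k _ => ?_
          -- The `N + 1` positions of the maximum and the factor `k + 1` of the integral bound turn
          -- `N.choose k` into `(N + 1).choose (k + 1)`.
          have hch : ((N : ENNReal) + 1) * N.choose k = (N + 1).choose (k + 1) * (k + 1) := by
            exact_mod_cast Nat.add_one_mul_choose_eq N k
          calc _ = ((N : ENNReal) + 1) * N.choose k * (∫⁻ a in {a | w a ≤ v}, (v - w a) ^ k ∂Q) *
                (Q Set.univ - v) ^ (N - k) := by ring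
            _ = (N + 1).choose (k + 1) *
                  ((k + 1) * ∫⁻ a in {a | w a ≤ v}, (v - w a) ^ k ∂Q) *
                (Q Set.univ - v) ^ (N - k) := by rw [hch]; ring
            _ ≤ (N + 1).choose (k + 1) * v ^ (k + 1) * (Q Set.univ - v) ^ (N - k) := by
                gcongr
                exact lintegral_upperMass_pow_le Q (hm 0) (h0 0) hv k
            _ = _ := by rw [Nat.add_sub_add_right]

end Core

/-! ### Removal of atoms, and the scenario bound for random samples -/

section Scenario

/-- `A` lies in the lower limit of the sets `B k`, so continuity from below along the increasing
tail intersections suffices. -/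
lemma measure_le_of_subset_eventually {α : Type*} [MeasurableSpace α] (μ : Measure α) {A : Set α}
    {B : ℕ → Set α} {C : ENNReal} (hA : ∀ x ∈ A, ∀ᶠ k in Filter.atTop, x ∈ B k)
    (hB : ∃ᶠ k in Filter.atTop, μ (B k) ≤ C) : μ A ≤ C := by
  have hsub : A ⊆ ⋃ n, ⋂ k ≥ n, B k := fun x hx => by
    obtain ⟨n, hn⟩ := Filter.eventually_atTop.1 (hA x hx)
    exact Set.mem_iUnion.2 ⟨n, Set.mem_iInter₂.2 hn⟩
  have hmono : Monotone fun n => ⋂ k ≥ n, B k := fun a b hab =>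
    Set.biInter_subset_biInter_left fun k (hk : b ≤ k) => hab.trans hk
  refine (measure_mono hsub).trans ?_
  rw [hmono.measure_iUnion]
  refine iSup_le fun n => ?_
  obtain ⟨k, hk, hBk⟩ := Filter.frequently_atTop.1 hB n
  exact (measure_mono (Set.iInter₂_subset k hk)).trans hBk

variable {S : Type*} [MeasurableSpace S]

/-- Scenario bound for the coordinatewise maximum of `N` independent samples: the probability that
a new sample exceeds this maximum in one of the `n` coordinates is at most `v`, up to a
probability given by the binomial tail. -/
theorem pi_lt_measure_exceedSet_le {n N : ℕ} (Q : Measure S) [IsFiniteMeasure Q]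
    {m : Fin n → S → ℝ} (hm : ∀ d, Measurable (m d)) {v : ENNReal} (hv : v ≠ ⊤) :
    (Measure.pi fun _ : Fin N => Q) {x | v < Q (exceedSet m x)} ≤
      binomTail n N (Q Set.univ) v := by
  -- An independent uniform variable, scaled by `1 / (k + 1)`, makes all level sets null. Strict
  -- inequalities survive small perturbations, so a point of the original exceedance set eventually
  -- lies in the perturbed ones.
  let U : Measure ℝ := volume.restrict (Set.Icc 0 1)
  have hU : IsProbabilityMeasure U := ⟨by simp [U]⟩
  let R : Measure (S × ℝ) := Q.prod U
  let mk : ℕ → Fin n → S × ℝ → ℝ := fun k d p => m d p.1 + p.2 * (1 / ((k : ℝ) + 1))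
  have hmk : ∀ k d, Measurable (mk k d) := fun k d =>
    ((hm d).comp measurable_fst).add (measurable_snd.mul_const _)
  have hnull : ∀ k d c, R {p | mk k d p = c} = 0 := fun k d c => by
    refine (Measure.measure_prod_null (measurableSet_eq_fun (hmk k d) measurable_const)).2
      (ae_of_all _ fun x => ?_)
    refine Set.Subsingleton.measure_zero (fun a ha b hb => ?_) U
    have hab : m d x + a * (1 / ((k : ℝ) + 1)) = m d x + b * (1 / ((k : ℝ) + 1)) :=
      Eq.trans ha (Eq.symm hb)
    have hk : (1 / ((k : ℝ) + 1)) ≠ 0 := by positivity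
    exact mul_right_cancel₀ hk (add_left_cancel hab)
  have hRuniv : R Set.univ = Q Set.univ := by
    rw [← Set.univ_prod_univ, Measure.prod_prod, measure_univ (μ := U), mul_one]
  have hfst : R.map Prod.fst = Q := by simp [R]
  have hpi : (Measure.pi fun _ : Fin N => R).map (fun x i => (x i).1) =
      Measure.pi fun _ : Fin N => Q := by
    rw [Measure.pi_map_pi fun _ => measurable_fst.aemeasurable]
    simp_rw [hfst]
  have hex : ∀ (x : Fin N → S × ℝ), ∀ p ∈ Prod.fst ⁻¹' exceedSet m (fun i => (x i).1),
      ∀ᶠ k in Filter.atTop, p ∈ exceedSet (mk k) x := by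
    rintro x p ⟨d, hd⟩
    have hlim : ∀ q : S × ℝ, Filter.Tendsto (fun k => mk k d q) Filter.atTop (nhds (m d q.1)) :=
      fun q => by
        simpa [mk] using (tendsto_one_div_add_atTop_nhds_zero_nat.const_mul q.2).const_add (m d q.1)
    filter_upwards [Filter.eventually_all.2 fun i => (hlim (x i)).eventually_lt (hlim p) (hd i)]
      with k hk using ⟨d, hk⟩
  rw [← hpi, Measure.map_apply (by fun_prop)
    (measurableSet_lt measurable_const (measurable_measure_exceedSet Q hm))]
  refine measure_le_of_subset_eventually _ (B := fun k => {x | v < R (exceedSet (mk k) x)}) ?_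
    (Filter.Frequently.of_forall fun k => ?_)
  · intro x hx
    have hx' : v < R (Prod.fst ⁻¹' exceedSet m (fun i => (x i).1)) := by
      rw [← Measure.map_apply measurable_fst (measurableSet_exceedSet hm _), hfst]
      exact hx
    -- Otherwise the perturbed exceedance sets have mass at most `v` infinitely often, and the limit
    -- lemma, applied now to `R`, bounds the original mass by `v`.
    by_contra hcon
    refine not_le.2 hx' (measure_le_of_subset_eventually R (hex x) ?_)
    exact (Filter.not_eventually.1 hcon).mono fun k hk => not_lt.1 hk
  · rw [← hRuniv]
    exact pi_lt_measure_exceedSet_le_of_noAtoms R (hmk k) (hnull k) hv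

lemma binomTail_ofReal_le {n N : ℕ} {q : ENNReal} (hq : q ≤ 1) {ε β : ℝ} (hε : ε ∈ Set.Ioo (0 : ℝ) 1)
    (h : SampleSizeCondition n 0 N ε β) :
    binomTail n N q (ENNReal.ofReal ε) ≤ ENNReal.ofReal β := by
  have h1 : 0 ≤ 1 - ε := sub_nonneg.2 hε.2.le
  calc binomTail n N q (ENNReal.ofReal ε)
      ≤ ∑ i ∈ Finset.range n, ENNReal.ofReal ((N.choose i : ℝ) * ε ^ i * (1 - ε) ^ (N - i)) := by
        refine Finset.sum_le_sum fun i _ => ?_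
        have h2 := hε.1.le
        rw [ENNReal.ofReal_mul (by positivity), ENNReal.ofReal_mul (by positivity),
          ENNReal.ofReal_natCast, ENNReal.ofReal_pow h2, ENNReal.ofReal_pow h1,
          ENNReal.ofReal_sub _ h2, ENNReal.ofReal_one]
        gcongr
    _ = ENNReal.ofReal (∑ i ∈ Finset.range n, (N.choose i : ℝ) * ε ^ i * (1 - ε) ^ (N - i)) := by
        have h2 := hε.1.le
        rw [ENNReal.ofReal_sum_of_nonneg fun i _ => by positivity]
    _ ≤ ENNReal.ofReal β := by
        refine ENNReal.ofReal_le_ofReal ?_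
        simpa [SampleSizeCondition] using h

/-- Scenario bound for random variables that are independent samples of `Q`. -/
theorem measure_lt_exceedSet_le_of_iIndepFun {n N : ℕ} {Q : Measure S} [IsFiniteMeasure Q]
    (hQ : Q Set.univ ≤ 1) {m : Fin n → S → ℝ} (hm : ∀ d, Measurable (m d)) {ε β : ℝ}
    (hε : ε ∈ Set.Ioo (0 : ℝ) 1) (hN : SampleSizeCondition n 0 N ε β)
    {Ω : Type*} [MeasurableSpace Ω] {μ : Measure Ω} [IsProbabilityMeasure μ]
    {ξ : Fin N → Ω → S} (hlaw : ∀ i, HasLaw (ξ i) Q μ) (hindep : iIndepFun ξ μ) :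
    μ {ω | ENNReal.ofReal ε < Q (exceedSet m fun i => ξ i ω)} ≤ ENNReal.ofReal β := by
  have hmap : μ.map (fun ω i => ξ i ω) = Measure.pi fun _ : Fin N => Q := by
    rw [hindep.map_fun_eq_pi_map fun i => (hlaw i).aemeasurable]
    simp_rw [fun i => (hlaw i).map_eq]
  have hae : AEMeasurable (fun ω i => ξ i ω) μ :=
    aemeasurable_pi_lambda _ fun i => (hlaw i).aemeasurable
  have := Measure.map_apply_of_aemeasurable hae
    (measurableSet_lt (measurable_const (a := ENNReal.ofReal ε))
      (measurable_measure_exceedSet (κ := Fin N) Q hm))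
  refine (this.symm.trans_le ?_).trans (binomTail_ofReal_le hQ hε hN)
  rw [hmap]
  exact pi_lt_measure_exceedSet_le Q hm ENNReal.ofReal_ne_top

end Scenario

/-! ### Support values of obstacle sets and collisions -/

namespace PlanningProblem

variable {T nx nu ny nX L LC : ℕ} (p : PlanningProblem T nx nu ny nX L)

lemma continuous_obstacle_constraint (hA : Continuous p.A) (y : Fin ny → ℝ) (j : Fin L) :
    Continuous fun x => (p.A x *ᵥ y) j :=
  (continuous_apply j).comp (hA.matrix_mulVec continuous_const)

lemma isOpen_mem_obstacle (hA : Continuous p.A) (hb : Continuous p.b) (y : Fin ny → ℝ) :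
    IsOpen {x | y ∈ p.obstacle x} := by
  have : {x | y ∈ p.obstacle x} = ⋂ j, {x | (p.A x *ᵥ y) j < p.b x j} := by
    ext x
    simp [obstacle]
  rw [this]
  exact isOpen_iInter_of_finite fun j => isOpen_lt (p.continuous_obstacle_constraint hA y j)
    ((continuous_apply j).comp hb)

lemma convex_obstacle (x : Fin nX → ℝ) : Convex ℝ (p.obstacle x) := by
  have : p.obstacle x = ⋂ j, {y | (p.A x *ᵥ y) j < p.b x j} := by
    ext y
    simp [obstacle]
  rw [this]
  exact convex_iInter fun j => convex_halfSpace_lt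
    (((LinearMap.proj j).comp (p.A x).mulVecLin).isLinear) _

lemma isClosed_halfspace (a : Matrix (Fin LC) (Fin ny) ℝ) (j : Fin LC) (c : ℝ) :
    IsClosed {y | (a *ᵥ y) j ≤ c} :=
  isClosed_le ((continuous_apply j).comp (continuous_const.matrix_mulVec continuous_id))
    continuous_const

/-- A linear bound at the vertices of a bounded obstacle set holds on the whole set. -/
lemma mulVec_le_of_vertices {x : Fin nX → ℝ} (hx : Bornology.IsBounded (p.obstacle x))
    (a : Matrix (Fin LC) (Fin ny) ℝ) (j : Fin LC) {c : ℝ}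
    (h : ∀ v ∈ p.vertices x, (a *ᵥ v) j ≤ c) {y : Fin ny → ℝ} (hy : y ∈ p.obstacle x) :
    (a *ᵥ y) j ≤ c := by
  have hcomp : IsCompact (closure (p.obstacle x)) := hx.isCompact_closure
  -- Krein-Milman: the closed halfspace contains the vertices, hence the closure of the obstacle
  -- set.
  have hkm := closure_convexHull_extremePoints hcomp (p.convex_obstacle x).closure
  have hconv : Convex ℝ {y | (a *ᵥ y) j ≤ c} :=
    convex_halfSpace_le (((LinearMap.proj j).comp a.mulVecLin).isLinear) _
  have hsub : closure (p.obstacle x) ⊆ {y | (a *ᵥ y) j ≤ c} := by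
    rw [← hkm]
    exact closure_minimal (convexHull_min h hconv) (isClosed_halfspace a j c)
  exact hsub (subset_closure hy)

/-- The supremum over the obstacle set of the `j`-th coordinate of `a y`, on the scale of `arctan`
(and below this scale if the obstacle set is empty). -/
noncomputable def obstacleSup (a : Matrix (Fin LC) (Fin ny) ℝ) (j : Fin LC) (x : Fin nX → ℝ) : ℝ :=
  -- `arctan` keeps the set bounded above even for an unbounded obstacle set. The value `-2 < -π /
  -- 2` keeps it nonempty and makes an empty obstacle set smaller than any other.
  sSup (insert (-2) ((fun y => Real.arctan ((a *ᵥ y) j)) '' p.obstacle x))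

lemma neg_two_lt_arctan (r : ℝ) : -2 < Real.arctan r := by
  linarith [Real.neg_pi_div_two_lt_arctan r, Real.pi_lt_four]

lemma obstacleSup_le {a : Matrix (Fin LC) (Fin ny) ℝ} {j : Fin LC} {x : Fin nX → ℝ} {c : ℝ}
    (h : ∀ y ∈ p.obstacle x, (a *ᵥ y) j ≤ c) : p.obstacleSup a j x ≤ Real.arctan c := by
  refine csSup_le (Set.insert_nonempty _ _) ?_
  rintro _ (rfl | ⟨y, hy, rfl⟩)
  · exact (neg_two_lt_arctan c).le
  · exact Real.arctan_strictMono.monotone (h y hy)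

lemma bddAbove_obstacleSup (a : Matrix (Fin LC) (Fin ny) ℝ) (j : Fin LC) (x : Fin nX → ℝ) :
    BddAbove (insert (-2) ((fun y => Real.arctan ((a *ᵥ y) j)) '' p.obstacle x)) := by
  refine ⟨Real.pi / 2, ?_⟩
  rintro _ (rfl | ⟨y, -, rfl⟩)
  · linarith [Real.pi_pos]
  · exact (Real.arctan_lt_pi_div_two _).le

lemma le_obstacleSup {a : Matrix (Fin LC) (Fin ny) ℝ} {j : Fin LC} {x : Fin nX → ℝ}
    {y : Fin ny → ℝ} (hy : y ∈ p.obstacle x) :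
    Real.arctan ((a *ᵥ y) j) ≤ p.obstacleSup a j x :=
  le_csSup (p.bddAbove_obstacleSup a j x) (Or.inr ⟨y, hy, rfl⟩)

/-- A supremum exceeds `c` when a single point `y` does, and membership of `y` in the obstacle set
is an open condition on `x`. The function is thus lower semicontinuous. -/
lemma measurable_obstacleSup (hA : Continuous p.A) (hb : Continuous p.b)
    (a : Matrix (Fin LC) (Fin ny) ℝ) (j : Fin LC) : Measurable (p.obstacleSup a j) := by
  refine measurable_of_Ioi fun c => IsOpen.measurableSet ?_
  have : p.obstacleSup a j ⁻¹' Set.Ioi c = {_x | c < -2} ∪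
      ⋃ y ∈ {y | c < Real.arctan ((a *ᵥ y) j)}, {x | y ∈ p.obstacle x} := by
    ext x
    simp only [Set.mem_preimage, Set.mem_Ioi, obstacleSup,
      lt_csSup_iff (p.bddAbove_obstacleSup a j x) (Set.insert_nonempty _ _)]
    simp only [Set.mem_insert_iff, Set.mem_image, Set.mem_union, Set.mem_ofPred_eq,
      Set.mem_iUnion, exists_prop]
    constructor
    · rintro ⟨_, rfl | ⟨y, hy, rfl⟩, hc⟩
      exacts [Or.inl hc, Or.inr ⟨y, hc, hy⟩]
    · rintro (hc | ⟨y, hc, hy⟩)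
      exacts [⟨_, Or.inl rfl, hc⟩, ⟨_, Or.inr ⟨y, hy, rfl⟩, hc⟩]
  rw [this]
  exact isOpen_const.union (isOpen_biUnion fun y _ => p.isOpen_mem_obstacle hA hb y)

lemma measurableSet_isBounded_obstacle (hA : Continuous p.A) (hb : Continuous p.b) :
    MeasurableSet {x | Bornology.IsBounded (p.obstacle x)} := by
  have : {x | Bornology.IsBounded (p.obstacle x)} =
      ⋃ n : ℕ, (⋃ y ∈ {y : Fin ny → ℝ | n < ‖y‖}, {x | y ∈ p.obstacle x})ᶜ := by
    ext x
    simp only [Set.mem_ofPred_eq, Set.mem_iUnion, Set.mem_compl_iff, exists_prop, not_exists,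
      not_and]
    rw [isBounded_iff_forall_norm_le]
    constructor
    · rintro ⟨C, hC⟩
      obtain ⟨n, hn⟩ := exists_nat_ge C
      exact ⟨n, fun y hy hyo => absurd ((hC y hyo).trans hn) (not_le.2 hy)⟩
    · rintro ⟨n, hn⟩
      exact ⟨n, fun y hy => not_lt.1 fun h => hn y h hy⟩
  rw [this]
  exact .iUnion fun n =>
    (isOpen_biUnion fun y _ => p.isOpen_mem_obstacle hA hb y).measurableSet.compl

/-- The trajectories of another vehicle that the ego outputs `y` collide with. -/
def collisionSet (y : Fin T → Fin ny → ℝ) : Set (Fin T → Fin nX → ℝ) :=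
  {s | ∃ t, y t ∈ p.obstacle (s t)}

lemma measurableSet_collisionSet (hA : Continuous p.A) (hb : Continuous p.b)
    (y : Fin T → Fin ny → ℝ) : MeasurableSet (p.collisionSet y) := by
  have : p.collisionSet y = ⋃ t, {s | y t ∈ p.obstacle (s t)} := by
    ext s
    simp [collisionSet]
  rw [this]
  exact .iUnion fun t => (p.isOpen_mem_obstacle hA hb (y t)).measurableSet.preimage
    (measurable_pi_apply t)

/-- The coordinates whose maximum over the samples determines the optimal bounding polytopes. -/
noncomputable def supCoord (Abar : Fin T → Matrix (Fin LC) (Fin ny) ℝ) (d : Fin (LC * T))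
    (s : Fin T → Fin nX → ℝ) : ℝ :=
  p.obstacleSup (Abar (finProdFinEquiv.symm d).2) (finProdFinEquiv.symm d).1
    (s (finProdFinEquiv.symm d).2)

lemma measurable_supCoord (hA : Continuous p.A) (hb : Continuous p.b)
    (Abar : Fin T → Matrix (Fin LC) (Fin ny) ℝ) (d : Fin (LC * T)) :
    Measurable (p.supCoord Abar d) :=
  (p.measurable_obstacleSup hA hb _ _).comp (measurable_pi_apply _)

/-- Outputs that avoid the bounding polytopes only collide with trajectories that exceed the
samples in one of the coordinates `supCoord`. -/
lemma collisionSet_subset_exceedSet {N : ℕ} {Abar : Fin T → Matrix (Fin LC) (Fin ny) ℝ}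
    {s : Fin N → Fin T → Fin nX → ℝ} {bbar : Fin T → Fin LC → ℝ}
    (hs : ∀ i t, Bornology.IsBounded (p.obstacle (s i t))) (hLP : p.LPFeasible Abar s bbar)
    {y : Fin T → Fin ny → ℝ} (hy : ∀ t, y t ∉ {z | ∀ j, (Abar t *ᵥ z) j ≤ bbar t j}) :
    p.collisionSet y ⊆ exceedSet (p.supCoord Abar) s := by
  rintro s' ⟨t, ht⟩
  obtain ⟨j, hj⟩ := not_forall.1 (hy t)
  refine ⟨finProdFinEquiv (j, t), fun i => ?_⟩
  simp only [supCoord, Equiv.symm_apply_apply]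
  calc p.obstacleSup (Abar t) j (s i t) ≤ Real.arctan (bbar t j) :=
        p.obstacleSup_le fun z hz =>
          p.mulVec_le_of_vertices (hs i t) _ _ (fun v hv => hLP t i v hv j) hz
    _ < Real.arctan ((Abar t *ᵥ y t) j) := Real.arctan_strictMono (not_le.1 hj)
    _ ≤ p.obstacleSup (Abar t) j (s' t) := p.le_obstacleSup ht

end PlanningProblem

/-! ### Cluster laws and the planning guarantee -/

section ClusterLaw

variable {O T nX : ℕ} (P : Measure (Fin O → Fin T → Fin nX → ℝ)) (o : Fin O)

lemma ae_clusterLaw {K : ℕ} (g : (Fin T → Fin nX → ℝ) → Fin K) (k : Fin K)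
    {q : (Fin T → Fin nX → ℝ) → Prop} (h : ∀ᵐ s ∂P.map (fun X => X o), q s) :
    ∀ᵐ s ∂clusterLaw P o g k, q s :=
  cond_absolutelyContinuous.ae_le h

/-- Law of total probability over the clusters of one vehicle. -/
lemma measure_le_sum_clusterLaw [IsFiniteMeasure P] (hP : P Set.univ ≤ 1) {K : ℕ}
    {g : (Fin T → Fin nX → ℝ) → Fin K} (hg : Measurable g) {D : Set (Fin T → Fin nX → ℝ)}
    (hD : MeasurableSet D) : P {X | X o ∈ D} ≤ ∑ k, clusterLaw P o g k D := by
  have hmap : P {X | X o ∈ D} = P.map (fun X => X o) D :=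
    (Measure.map_apply (measurable_pi_apply o) hD).symm
  have hcov : D ⊆ ⋃ k, g ⁻¹' {k} ∩ D := fun s hs => Set.mem_iUnion.2 ⟨g s, rfl, hs⟩
  rw [hmap]
  refine (measure_mono hcov).trans ((measure_iUnion_fintype_le _ _).trans
    (Finset.sum_le_sum fun k _ => ?_))
  rw [← cond_mul_eq_inter (hg (measurableSet_singleton k))]
  -- The cluster probability is bounded by 1, so the cluster risks add up without weights.
  refine mul_le_of_le_one_right' ((measure_mono (Set.subset_univ _)).trans ?_)
  rwa [Measure.map_apply (measurable_pi_apply o) .univ]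

end ClusterLaw

lemma ae_clusterLaw_isBounded_obstacle {T O nx nu ny nX L : ℕ}
    (p : PlanningProblem T nx nu ny nX L) (hA : Continuous p.A) (hb : Continuous p.b)
    {P : Measure (Fin O → Fin T → Fin nX → ℝ)}
    (hbdd : ∀ᵐ X ∂P, ∀ o t, Bornology.IsBounded (p.obstacle (X o t))) (o : Fin O) {K : ℕ}
    (g : (Fin T → Fin nX → ℝ) → Fin K) (k : Fin K) :
    ∀ᵐ s ∂clusterLaw P o g k, ∀ t, Bornology.IsBounded (p.obstacle (s t)) := by
  refine ae_clusterLaw P o g k (ae_all_iff.2 fun t => ?_)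
  have hm : MeasurableSet {s : Fin T → Fin nX → ℝ | Bornology.IsBounded (p.obstacle (s t))} :=
    (p.measurableSet_isBounded_obstacle hA hb).preimage (measurable_pi_apply t)
  exact (ae_map_iff (measurable_pi_apply o).aemeasurable hm).2 (hbdd.mono fun X h => h o t)

/-- The samples of one cluster for which the scenario solution misses more than the mass `ε` of the
cluster, or which are not samples of polytopes, have probability at most `β`. -/
lemma measure_bad_samples_le {T O nx nu ny nX L LC : ℕ}
    (p : PlanningProblem T nx nu ny nX L) (hA : Continuous p.A) (hb : Continuous p.b)
    {P : Measure (Fin O → Fin T → Fin nX → ℝ)}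
    (hbdd : ∀ᵐ X ∂P, ∀ o t, Bornology.IsBounded (p.obstacle (X o t))) (o : Fin O) {K : ℕ}
    (g : (Fin T → Fin nX → ℝ) → Fin K) (k : Fin K)
    (Abar : Fin T → Matrix (Fin LC) (Fin ny) ℝ) {ε β : ℝ} (hε : ε ∈ Set.Ioo (0 : ℝ) 1) {N : ℕ}
    (hN : SampleSizeCondition (LC * T) 0 N ε β)
    {Ω : Type*} [MeasurableSpace Ω] {μ : Measure Ω} [IsProbabilityMeasure μ]
    {ξ : Fin N → Ω → Fin T → Fin nX → ℝ} (hlaw : ∀ i, HasLaw (ξ i) (clusterLaw P o g k) μ)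
    (hindep : iIndepFun ξ μ) :
    μ {ω | ¬ ((∀ i t, Bornology.IsBounded (p.obstacle (ξ i ω t))) ∧
      clusterLaw P o g k (exceedSet (p.supCoord Abar) fun i => ξ i ω) ≤ ENNReal.ofReal ε)} ≤
      ENNReal.ofReal β := by
  -- Conditioning on a cluster of probability 0 gives the zero measure.
  have hQ : IsZeroOrProbabilityMeasure (clusterLaw P o g k) := by
    unfold clusterLaw
    infer_instance
  have hnull : μ {ω | ¬ ∀ i t, Bornology.IsBounded (p.obstacle (ξ i ω t))} = 0 :=
    ae_all_iff.2 fun i => ae_of_ae_map (hlaw i).aemeasurable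
      ((hlaw i).map_eq.symm ▸ ae_clusterLaw_isBounded_obstacle p hA hb hbdd o g k)
  calc _ ≤ μ ({ω | ¬ ∀ i t, Bornology.IsBounded (p.obstacle (ξ i ω t))} ∪
        {ω | ENNReal.ofReal ε <
          clusterLaw P o g k (exceedSet (p.supCoord Abar) fun i => ξ i ω)}) :=
        measure_mono fun ω hω => (not_and_or.1 hω).imp id not_le.1
    _ ≤ 0 + ENNReal.ofReal β := (measure_union_le _ _).trans (add_le_add hnull.le
        (measure_lt_exceedSet_le_of_iIndepFun prob_le_one (p.measurable_supCoord hA hb Abar) hε hN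
          hlaw hindep))
    _ = ENNReal.ofReal β := zero_add _

theorem theorem1 {T O nx nu ny nX L LC : ℕ}
    (p : PlanningProblem T nx nu ny nX L)
    (hA : Continuous p.A) (hb : Continuous p.b)
    -- joint law of the predicted trajectories of the other vehicles
    (P : Measure (Fin O → Fin T → Fin nX → ℝ)) [IsProbabilityMeasure P]
    -- the obstacle sets are polytopes
    (hbdd : ∀ᵐ X ∂P, ∀ o t, Bornology.IsBounded (p.obstacle (X o t)))
    -- clustering functions
    (K : Fin O → ℕ) (g : (o : Fin O) → (Fin T → Fin nX → ℝ) → Fin (K o))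
    (hg : ∀ o, Measurable (g o))
    -- predetermined normal vectors of the bounding polytopes
    (Abar : (o : Fin O) → Fin (K o) → Fin T → Matrix (Fin LC) (Fin ny) ℝ)
    -- risk level and confidence bound, and their allocation
    (ε β : ℝ) (hε : ε ∈ Set.Ioo (0 : ℝ) 1) (hβ : β ∈ Set.Ioo (0 : ℝ) 1)
    (εc βc : (o : Fin O) → Fin (K o) → ℝ)
    (hεc : ∀ o k, εc o k ∈ Set.Ioo (0 : ℝ) 1) (hβc : ∀ o k, βc o k ∈ Set.Ioo (0 : ℝ) 1)
    (hεsum : ∑ o, ∑ k, εc o k = ε) (hβsum : ∑ o, ∑ k, βc o k = β)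
    -- sample sizes
    (N : (o : Fin O) → Fin (K o) → ℕ)
    (hN : ∀ o k, SampleSizeCondition (LC * T) 0 (N o k) (εc o k) (βc o k))
    -- for each pair `(o, k)`, independent samples of the trajectory of `o` in cluster `k`
    {Ω : Type*} [MeasurableSpace Ω] (μ : Measure Ω) [IsProbabilityMeasure μ]
    (ξ : (o : Fin O) → (k : Fin (K o)) → Fin (N o k) → Ω → (Fin T → Fin nX → ℝ))
    (hlaw : ∀ o k i, HasLaw (ξ o k i) (clusterLaw P o (g o) k) μ)
    (hindep : ∀ o k, iIndepFun (ξ o k) μ) :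
    ∃ E : Set Ω, MeasurableSet E ∧ 1 - β ≤ μ.real E ∧
      ∀ ω ∈ E, ∀ bbar : (o : Fin O) → Fin (K o) → Fin T → Fin LC → ℝ,
        (∀ o k, p.LPFeasible (Abar o k) (fun i => ξ o k i ω) (bbar o k)) →
        ∀ u x y, p.PolytopeFeasible Abar bbar u x y → p.ChanceFeasible P ε u x y := by
  let good : (o : Fin O) → Fin (K o) → Set Ω := fun o k =>
    {ω | (∀ i t, Bornology.IsBounded (p.obstacle (ξ o k i ω t))) ∧
      clusterLaw P o (g o) k (exceedSet (p.supCoord (Abar o k)) fun i => ξ o k i ω) ≤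
        ENNReal.ofReal (εc o k)}
  let bad : Set Ω := ⋃ o, ⋃ k, (good o k)ᶜ
  have hbad : μ bad ≤ ENNReal.ofReal β := by
    calc μ bad ≤ ∑ o, ∑ k, μ (good o k)ᶜ := (measure_iUnion_fintype_le _ _).trans
          (Finset.sum_le_sum fun o _ => measure_iUnion_fintype_le _ _)
      _ ≤ ∑ o, ∑ k, ENNReal.ofReal (βc o k) :=
          Finset.sum_le_sum fun o _ => Finset.sum_le_sum fun k _ =>
            measure_bad_samples_le p hA hb hbdd o (g o) k (Abar o k) (hεc o k) (hN o k)
              (hlaw o k) (hindep o k)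
      _ = ENNReal.ofReal β := by
          rw [← hβsum, ENNReal.ofReal_sum_of_nonneg fun o _ =>
            Finset.sum_nonneg fun k _ => (hβc o k).1.le]
          exact Finset.sum_congr rfl fun o _ =>
            (ENNReal.ofReal_sum_of_nonneg fun k _ => (hβc o k).1.le).symm
  -- The samples are only a.e. measurable, so `bad` is replaced by a measurable superset of equal
  -- mass.
  refine ⟨(toMeasurable μ bad)ᶜ, (measurableSet_toMeasurable _ _).compl, ?_, ?_⟩
  · rw [probReal_compl_eq_one_sub (measurableSet_toMeasurable _ _)]
    have : μ.real (toMeasurable μ bad) ≤ β := by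
      rw [measureReal_def, measure_toMeasurable]
      exact ENNReal.toReal_le_of_le_ofReal hβ.1.le hbad
    linarith
  intro ω hω bbar hLP u x y ⟨htraj, hy⟩
  have hgood : ∀ o k, ω ∈ good o k := fun o k => by
    by_contra h
    exact hω (subset_toMeasurable μ bad (Set.mem_iUnion₂.2 ⟨o, k, h⟩))
  refine ⟨htraj, ?_⟩
  have hcol := p.measurableSet_collisionSet hA hb y
  have hcompl : {X : Fin O → Fin T → Fin nX → ℝ | ∀ t o, y t ∉ p.obstacle (X o t)} =
      (⋃ o, {X : Fin O → Fin T → Fin nX → ℝ | X o ∈ p.collisionSet y})ᶜ := by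
    ext X
    simp only [PlanningProblem.collisionSet, Set.mem_ofPred_eq, Set.mem_compl_iff, Set.mem_iUnion,
      not_exists]
    exact forall_comm
  have hle : P (⋃ o, {X : Fin O → Fin T → Fin nX → ℝ | X o ∈ p.collisionSet y}) ≤
      ENNReal.ofReal ε := by
    calc _ ≤ ∑ o, P {X : Fin O → Fin T → Fin nX → ℝ | X o ∈ p.collisionSet y} :=
          measure_iUnion_fintype_le _ _
      _ ≤ ∑ o, ∑ k, clusterLaw P o (g o) k (p.collisionSet y) :=
          Finset.sum_le_sum fun o _ => measure_le_sum_clusterLaw P o prob_le_one (hg o) hcol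
      _ ≤ ∑ o, ∑ k, ENNReal.ofReal (εc o k) :=
          Finset.sum_le_sum fun o _ => Finset.sum_le_sum fun k _ =>
            (measure_mono (p.collisionSet_subset_exceedSet (hgood o k).1 (hLP o k) (hy o k))).trans
              (hgood o k).2
      _ = ENNReal.ofReal ε := by
          rw [← hεsum, ENNReal.ofReal_sum_of_nonneg fun o _ =>
            Finset.sum_nonneg fun k _ => (hεc o k).1.le]
          exact Finset.sum_congr rfl fun o _ =>
            (ENNReal.ofReal_sum_of_nonneg fun k _ => (hεc o k).1.le).symm
  have hmeas : MeasurableSet (⋃ o, {X : Fin O → Fin T → Fin nX → ℝ | X o ∈ p.collisionSet y}) :=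
    .iUnion fun o => hcol.preimage (measurable_pi_apply o)
  rw [hcompl, probReal_compl_eq_one_sub hmeas]
  have := ENNReal.toReal_le_of_le_ofReal hε.1.le hle
  rw [← measureReal_def] at this
  linarith
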